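/- Consider a stochastic multi-armed bandit with arms $1,\dots,K$, where arm $k$ gives $\mathrm{Bernoulli}(\mu_k)$ rewards, $1>\mu_1>\mu_2\ge\dots\ge\mu_K>0$, and let $\Delta_k=\mu_1-\mu_k$. There are $n$ honest agents $1,\dots,n$ and one malicious agent $n+1$. Let $\alpha,\beta>1$, let $A_j=\lceil j^\beta\rceil$, and let $\hat S^{(1)},\dots,\hat S^{(n)}\subset\{1,\dots,K\}$ (the sticky sets) be of a common size $S$ with $1\in\bigcup_{i=1}^n\hat S^{(i)}$. Each honest agent $i$ runs the following algorithm without blocking (ties in argmax are resolved arbitrarily). Initially $U^{(i)}_1\ne L^{(i)}_1$ are arms outside $\hat S^{(i)}$, and $S^{(i)}_1=\hat S^{(i)}\cup\{U^{(i)}_1,L^{(i)}_1\}$. At each time $t\in\{A_{j-1}+1,\dots,A_j\}$ (phase $j\ge1$), agent $i$ pulls an arm $$I_t^{(i)}\in\arg\max_{k\in S_j^{(i)}}\ \hat\mu_k^{(i)}(t-1)+\sqrt{\frac{\alpha\log t}{T_k^{(i)}(t-1)}},$$ where $T_k^{(i)}(t-1)$ and $\hat\mu^{(i)}_k(t-1)$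 are the number of pulls and the average reward of arm $k$ for agent $i$ before time $t$ (the index is $+\infty$ if $T_k^{(i)}(t-1)=0$). At time $A_j$, agent $i$ determines its most played arm of the phase, $B_j^{(i)}\in\arg\max_{k\in S_j^{(i)}}T_k^{(i)}(A_j)-T_k^{(i)}(A_{j-1})$, and contacts an agent $H_j^{(i)}$ that is uniformly distributed on $\{1,\dots,n+1\}\setminus\{i\}$. It receives the recommendation $R_j^{(i)}=B_j^{(i')}$ if $i'=H_j^{(i)}$ is honest, while the malicious agent recommends a uniformly random arm in $\{1,\dots,K\}$. If $R_j^{(i)}\in S_j^{(i)}$, the active set and the non-sticky arms do not change. Otherwise $U^{(i)}_{j+1}\in\arg\max_{k\in\{U_j^{(i)},L_j^{(i)}\}}T_k^{(i)}(A_j)-T_k^{(i)}(A_{j-1})$, $L^{(i)}_{j+1}=R_j^{(i)}$ and $S^{(i)}_{j+1}=\hat S^{(i)}\cup\{U^{(i)}_{j+1},L^{(i)}_{j+1}\}$. The rewards (over all agents, arms and successive pulls), the contacts $H_j^{(i)}$ and the malicious recommendations (over all agents and phases) are jointly independent. Let $R_T^{(i)}=\sum_{t=1}^T\Delta_{I_t^{(i)}}$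 be the regret of agent $i$ at horizon $T$. Then for every $\varepsilon\in(0,1)$ and every $i\in\{1,\dots,n\}$, $$\lim_{T\to\infty}\mathbb P\left(\frac{R_T^{(i)}}{\log T}\ge(1-\varepsilon)\,\alpha\left(1-\frac1{\sqrt\alpha}\right)^2\sum_{k=2}^K\frac1{\Delta_k}\right)=1,$$ and consequently $$\liminf_{T\to\infty}\frac{\mathbb E R_T^{(i)}}{\log T}\ge\alpha\left(1-\frac1{\sqrt\alpha}\right)^2\sum_{k=2}^K\frac1{\Delta_k}.$$ -/

import Mathlib

open MeasureTheory ProbabilityTheory Filter Topology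

namespace GossipBandit

/-- The three places where the algorithm selects an element of an argmax set: the arm that is
pulled, the most played active arm of a phase, and the most played non-sticky active arm. -/
inductive ArgmaxUse
  | pull
  | mostPlayed
  | keep

/-- One realization of all the inputs of the system with `n` honest agents, one malicious agent
and `K` arms. The agents are `Fin (n + 1)`: agent `c` is honest if `c < n`, and agent `n` is the
malicious one. The arms are `Fin K`, and arm `0` will be the best arm.
* `reward i k s` is the reward that honest agent `i` gets from its `(s + 1)`-th pull of arm `k`;
* `contact i j` is the agent `H_j^{(i)}` that honest agent `i` contacts at the end of phase `j`;
* `malicious i j` is the arm that the malicious agent recommends to `i` at the end of phase `j`,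
  if it is contacted by `i` then;
* `initU i` and `initL i` are the non-sticky arms of honest agent `i` in the first phase;
* `tie` resolves the ties: `tie u i r s` is the element of the argmax set `s` that agent `i`
  selects, where `r` is the time for `u = pull` and the phase for `mostPlayed` and `keep`. -/
structure Randomness (n K : ℕ) where
  reward : Fin n → Fin K → ℕ → ℝ
  contact : Fin n → ℕ → Fin (n + 1)
  malicious : Fin n → ℕ → Fin K
  initU : Fin n → Fin K
  initL : Fin n → Fin K
  tie : ArgmaxUse → Fin n → ℕ → Finset (Fin K) → Fin K

/-- The communication epochs `A_j = ⌈j ^ β⌉`. -/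
noncomputable def epoch (β : ℝ) (j : ℕ) : ℕ := ⌈(j : ℝ) ^ β⌉₊

/-- The variables of all honest agents after `t` pulls. -/
structure State (n K : ℕ) where
  /-- the current phase `j` -/
  phase : ℕ
  /-- `plays i k` is the number `T_k^{(i)}(t)` of pulls of arm `k` by agent `i` so far -/
  plays : Fin n → Fin K → ℕ
  /-- `epochPlays i k` is `T_k^{(i)}(A_{j-1})`, the number of pulls before the current phase -/
  epochPlays : Fin n → Fin K → ℕ
  /-- the non-sticky active arms `U_j^{(i)}` -/
  U : Fin n → Fin K
  /-- the non-sticky active arms `L_j^{(i)}` -/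
  L : Fin n → Fin K

/-- The elements of `s` at which `f` is maximal over `s`. -/
noncomputable def argmaxSet {ι R : Type*} [LinearOrder R] (s : Finset ι) (f : ι → R) :
    Finset ι :=
  s.filter (fun k => ∀ l ∈ s, f l ≤ f k)

/-- The state before the first pull: phase `1`, no pulls. -/
def initialState {n K : ℕ} (x : Randomness n K) : State n K where
  phase := 1
  plays := fun _ _ => 0
  epochPlays := fun _ _ => 0
  U := x.initU
  L := x.initL

/-- The active set `S_j^{(i)}`: sticky arms together with the two non-sticky active arms. -/
def active {n K : ℕ} (sticky : Fin n → Finset (Fin K)) (σ : State n K) (i : Fin n) :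
    Finset (Fin K) :=
  sticky i ∪ {σ.U i, σ.L i}

/-- The average reward that agent `i` has observed from arm `k` so far. -/
noncomputable def empiricalMean {n K : ℕ} (x : Randomness n K) (σ : State n K) (i : Fin n)
    (k : Fin K) : ℝ :=
  (∑ s ∈ Finset.range (σ.plays i k), x.reward i k s) / (σ.plays i k : ℝ)

/-- The `UCB(α)` index of arm `k` for agent `i` at time `t`; as usual it is `∞` for an arm that
has not been pulled yet. -/
noncomputable def ucbIndex {n K : ℕ} (α : ℝ) (x : Randomness n K) (σ : State n K) (t : ℕ)
    (i : Fin n) (k : Fin K) : EReal :=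
  if σ.plays i k = 0 then ⊤
  else ((empiricalMean x σ i k + √(α * Real.log (t : ℝ) / (σ.plays i k : ℝ)) : ℝ) : EReal)

/-- The arm `I_t^{(i)}` that agent `i` pulls at time `t`, if `σ` is the state after `t - 1`
pulls. -/
noncomputable def pullFrom {n K : ℕ} (α : ℝ) (sticky : Fin n → Finset (Fin K))
    (x : Randomness n K) (t : ℕ) (σ : State n K) (i : Fin n) : Fin K :=
  x.tie ArgmaxUse.pull i t (argmaxSet (active sticky σ i) (ucbIndex α x σ t i))

/-- The recommendation `R_j^{(i)}` that agent `i` receives at the end of phase `j`, without any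
blocking: an honest agent `c` recommends its most played arm `B c`, the malicious agent
recommends `x.malicious i j`. -/
def recommendation {n K : ℕ} (x : Randomness n K) (j : ℕ) (B : Fin n → Fin K) (i : Fin n) :
    Fin K :=
  if h : (x.contact i j : ℕ) < n then B ⟨x.contact i j, h⟩ else x.malicious i j

/-- Time step `t`: every honest agent pulls an arm and, if `t` is the epoch that ends the current
phase, determines its most played active arm, receives a recommendation, updates its non-sticky
active arms (unless the recommendation is already active), and enters the next phase. -/
noncomputable def step {n K : ℕ} (α β : ℝ) (sticky : Fin n → Finset (Fin K))
    (x : Randomness n K) (t : ℕ) (σ : State n K) : State n K :=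
  let newPlays : Fin n → Fin K → ℕ := fun i k =>
    σ.plays i k + if k = pullFrom α sticky x t σ i then 1 else 0
  if t = epoch β σ.phase then
    let phasePlays : Fin n → Fin K → ℕ := fun i k => newPlays i k - σ.epochPlays i k
    let B : Fin n → Fin K := fun i =>
      x.tie ArgmaxUse.mostPlayed i σ.phase (argmaxSet (active sticky σ i) (phasePlays i))
    let R : Fin n → Fin K := recommendation x σ.phase B
    { phase := σ.phase + 1
      plays := newPlays
      epochPlays := newPlays
      U := fun i =>
        if R i ∈ active sticky σ i then σ.U i
        else x.tie ArgmaxUse.keep i σ.phase (argmaxSet {σ.U i, σ.L i} (phasePlays i))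
      L := fun i => if R i ∈ active sticky σ i then σ.L i else R i }
  else
    { phase := σ.phase
      plays := newPlays
      epochPlays := σ.epochPlays
      U := σ.U
      L := σ.L }

/-- The state after `t` pulls. -/
noncomputable def state {n K : ℕ} (α β : ℝ) (sticky : Fin n → Finset (Fin K))
    (x : Randomness n K) : ℕ → State n K
  | 0 => initialState x
  | t + 1 => step α β sticky x (t + 1) (state α β sticky x t)

/-- The arm `I_t^{(i)}` that agent `i` pulls at time `t ≥ 1`. -/
noncomputable def pull {n K : ℕ} (α β : ℝ) (sticky : Fin n → Finset (Fin K))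
    (x : Randomness n K) (t : ℕ) (i : Fin n) : Fin K :=
  pullFrom α sticky x t (state α β sticky x (t - 1)) i

/-- The arm gap `Δ_k`, where arm `0` is the best arm. -/
def gap {K : ℕ} [NeZero K] (μ : Fin K → unitInterval) (k : Fin K) : ℝ := (μ 0 : ℝ) - (μ k : ℝ)

/-- The regret `R_T^{(i)} = ∑_{t = 1}^T Δ_{I_t^{(i)}}` as a function of the realization. -/
noncomputable def regret {n K : ℕ} [NeZero K] (μ : Fin K → unitInterval) (α β : ℝ)
    (sticky : Fin n → Finset (Fin K)) (x : Randomness n K) (i : Fin n) (T : ℕ) : ℝ :=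
  ∑ t ∈ Finset.Icc 1 T, gap μ (pull α β sticky x t i)

/-- The labels of the primitive random variables. -/
inductive Source (n K : ℕ)
  | reward (i : Fin n) (k : Fin K) (s : ℕ)
  | contact (i : Fin n) (j : ℕ)
  | malicious (i : Fin n) (j : ℕ)

/-- The σ-algebra generated by a primitive random variable. -/
@[reducible]
def Source.sigmaAlgebra {Ω : Type*} {n K : ℕ} (ξ : Ω → Randomness n K) :
    Source n K → MeasurableSpace Ω
  | .reward i k s => MeasurableSpace.comap (fun ω => (ξ ω).reward i k s) inferInstance
  | .contact i j => MeasurableSpace.comap (fun ω => (ξ ω).contact i j) inferInstance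
  | .malicious i j => MeasurableSpace.comap (fun ω => (ξ ω).malicious i j) inferInstance

/-- The probabilistic model: rewards of arm `k` are Bernoulli with mean `μ k`, each honest agent
contacts a uniformly random other agent at each epoch, the malicious agent recommends uniformly
random arms, and all these random variables are jointly independent. The resolution of ties and
the two distinct non-sticky arms of the first phase may be arbitrary random choices. -/
structure IsModel {Ω : Type*} [MeasurableSpace Ω] (P : Measure Ω) {n K : ℕ}
    (μ : Fin K → unitInterval) (sticky : Fin n → Finset (Fin K)) (ξ : Ω → Randomness n K) :
    Prop where
  measurable_reward : ∀ i k s, Measurable (fun ω => (ξ ω).reward i k s)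
  measurable_contact : ∀ i j, Measurable (fun ω => (ξ ω).contact i j)
  measurable_malicious : ∀ i j, Measurable (fun ω => (ξ ω).malicious i j)
  measurable_initU : ∀ i, Measurable (fun ω => (ξ ω).initU i)
  measurable_initL : ∀ i, Measurable (fun ω => (ξ ω).initL i)
  measurable_tie : ∀ u i r s, Measurable (fun ω => (ξ ω).tie u i r s)
  law_reward : ∀ i k s, P.map (fun ω => (ξ ω).reward i k s) = bernoulliMeasure 1 0 (μ k)
  law_contact : ∀ i j, P.map (fun ω => (ξ ω).contact i j) = uniformOn {c | c ≠ i.castSucc}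
  law_malicious : ∀ i j, P.map (fun ω => (ξ ω).malicious i j) = uniformOn Set.univ
  indep : iIndep (Source.sigmaAlgebra ξ) P
  tie_mem : ∀ ω u i r s, s.Nonempty → (ξ ω).tie u i r s ∈ s
  initU_ne_initL : ∀ ω i, (ξ ω).initU i ≠ (ξ ω).initL i
  initU_notMem : ∀ ω i, (ξ ω).initU i ∉ sticky i
  initL_notMem : ∀ ω i, (ξ ω).initL i ∉ sticky i

end GossipBandit

namespace GossipBandit

/-! The malicious agent keeps every suboptimal arm `k` alive. Fix `0 < q < r < √α - 1` and put `ρ =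
(1 + r)² / α < 1`. The phases ending between times of order `T ^ ρ` and `T` number polynomially many
in `T`. In each of them arm `k` is recommended maliciously to agent `i` with probability `1 / (n
K)`, independently over phases, so with probability tending to one this happens at least once for
every arm.

After such a recommendation, `k` is active throughout a whole phase, whose length is polynomial in
`T`. At those times `α log t ≥ (1 + r)² log T`, while by Hoeffding the empirical mean after `s`
pulls errs by at most `√(log T / s)`. If `k` had fewer than `q² log T / Δ_k²` pulls, its index would
therefore exceed `μ_k + r Δ_k / q`, which lies above the best mean by a fixed margin. Every pulled
arm, the best one included, would need an index this large, which is possible only during its first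
`O(log T)` pulls. The phase is too long for that (`le_plays_of_active`, `le_plays_of_malicious`).

Hence every suboptimal arm costs at least `q² log T / Δ_k`. Letting `q` approach `√α - 1` gives the
constant, since `(√α - 1)² = α (1 - 1/√α)²`. Markov's inequality transfers the bound to
expectations. -/

/-! ### Growth of the communication epochs. -/

lemma epoch_zero {β : ℝ} (hβ : 1 < β) : epoch β 0 = 0 := by
  simp [epoch, Real.zero_rpow (by linarith : β ≠ 0)]

lemma rpow_add_rpow_sub_one_le {β : ℝ} (hβ : 1 < β) (j : ℕ) :
    (j : ℝ) ^ β + ((j : ℝ) + 1) ^ (β - 1) ≤ ((j : ℝ) + 1) ^ β := by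
  have hj : (0 : ℝ) ≤ j := j.cast_nonneg
  have h1 : ((j : ℝ) + 1) ^ β = ((j : ℝ) + 1) ^ (β - 1) * (j + 1) := by
    rw [← Real.rpow_add_one (by positivity)]; simp
  have h2 : (j : ℝ) ^ β = (j : ℝ) ^ (β - 1) * j := by
    rw [← Real.rpow_add_one' hj (by linarith)]; simp
  have h3 : (j : ℝ) ^ (β - 1) ≤ ((j : ℝ) + 1) ^ (β - 1) :=
    Real.rpow_le_rpow hj (by linarith) (by linarith)
  rw [h1, h2]
  nlinarith

lemma rpow_le_epoch (β : ℝ) (j : ℕ) : (j : ℝ) ^ β ≤ epoch β j := Nat.le_ceil _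

/-- Phase lengths grow polynomially, which eventually beats any multiple of `log T`; rounding up
costs at most one. -/
lemma epoch_add_rpow_le {β : ℝ} (hβ : 1 < β) (j : ℕ) :
    (epoch β j : ℝ) + ((j : ℝ) + 1) ^ (β - 1) ≤ epoch β (j + 1) + 1 := by
  have h1 : (epoch β j : ℝ) < (j : ℝ) ^ β + 1 := Nat.ceil_lt_add_one (by positivity)
  have h2 := rpow_le_epoch β (j + 1)
  push_cast at h2
  linarith [rpow_add_rpow_sub_one_le hβ j]

lemma epoch_lt_succ {β : ℝ} (hβ : 1 < β) (j : ℕ) : epoch β j < epoch β (j + 1) := by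
  have h1 : (1 : ℝ) ≤ ((j : ℝ) + 1) ^ (β - 1) :=
    Real.one_le_rpow (by linarith [(j.cast_nonneg : (0 : ℝ) ≤ j)]) (by linarith)
  have h2 : (j : ℝ) ^ β + 1 ≤ ((j + 1 : ℕ) : ℝ) ^ β := by
    push_cast
    linarith [rpow_add_rpow_sub_one_le hβ j]
  -- The rounding loss in `epoch_add_rpow_le` would leave only a weak inequality; a shift by exactly
  -- 1 commutes with the ceiling.
  calc epoch β j < ⌈(j : ℝ) ^ β⌉₊ + 1 := Nat.lt_succ_self _
    _ = ⌈(j : ℝ) ^ β + 1⌉₊ := (Nat.ceil_add_one (by positivity)).symm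
    _ ≤ epoch β (j + 1) := Nat.ceil_mono h2

lemma epoch_strictMono {β : ℝ} (hβ : 1 < β) : StrictMono (epoch β) :=
  strictMono_nat_of_lt_succ (epoch_lt_succ hβ)

/-! ### Deterministic analysis of one realization. -/

section Dynamics

variable {n K : ℕ} {α β : ℝ} {sticky : Fin n → Finset (Fin K)} {x : Randomness n K}

lemma state_succ (t : ℕ) :
    state α β sticky x (t + 1) = step α β sticky x (t + 1) (state α β sticky x t) := rfl

lemma plays_succ (t : ℕ) (i : Fin n) (k : Fin K) :
    (state α β sticky x (t + 1)).plays i k = (state α β sticky x t).plays i k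
      + if k = pull α β sticky x (t + 1) i then 1 else 0 := by
  by_cases h : t + 1 = epoch β (state α β sticky x t).phase
  · rw [state_succ, step, if_pos h]
    rfl
  · rw [state_succ, step, if_neg h]
    rfl

lemma phase_succ (t : ℕ) :
    (state α β sticky x (t + 1)).phase = if t + 1 = epoch β (state α β sticky x t).phase
      then (state α β sticky x t).phase + 1 else (state α β sticky x t).phase := by
  rw [state_succ, step]
  split_ifs <;> rfl

lemma phase_spec (hβ : 1 < β) (t : ℕ) : ∃ j, (state α β sticky x t).phase = j + 1 ∧
    epoch β j ≤ t ∧ t < epoch β (j + 1) := by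
  induction t with
  | zero => exact ⟨0, rfl, (epoch_zero hβ).le, (Nat.zero_le _).trans_lt (epoch_lt_succ hβ 0)⟩
  | succ t ih =>
    obtain ⟨j, hj, h1, h2⟩ := ih
    rw [phase_succ, hj]
    split_ifs with h
    · exact ⟨j + 1, rfl, h.ge, by have := epoch_lt_succ hβ (j + 1); omega⟩
    · exact ⟨j, rfl, by omega, by omega⟩

lemma phase_eq (hβ : 1 < β) {t j : ℕ} (h1 : epoch β j ≤ t) (h2 : t < epoch β (j + 1)) :
    (state α β sticky x t).phase = j + 1 := by
  obtain ⟨l, hl, h3, h4⟩ := phase_spec (α := α) (sticky := sticky) (x := x) hβ t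
  have h5 := (epoch_strictMono hβ).lt_iff_lt.1 (h1.trans_lt h4)
  have h6 := (epoch_strictMono hβ).lt_iff_lt.1 (h3.trans_lt h2)
  omega

lemma active_state_eq (hβ : 1 < β) (i : Fin n) {t j : ℕ} (h1 : epoch β j ≤ t)
    (h2 : t < epoch β (j + 1)) :
    active sticky (state α β sticky x t) i
      = active sticky (state α β sticky x (epoch β j)) i := by
  induction t, h1 using Nat.le_induction with
  | base => rfl
  | succ t h1 ih =>
    rw [← ih (by omega), state_succ, step, phase_eq hβ h1 (by omega), if_neg (by omega)]
    rfl

/-- A recommendation that is not yet active becomes the new `L`. The state at time `epoch β j` is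
already in phase `j + 1`, so the two alternatives mean that `k` is active throughout phase `j + 1`
or throughout phase `j + 2`. -/
lemma mem_active_of_malicious (hβ : 1 < β) {i : Fin n} {j : ℕ} {k : Fin K}
    (hc : x.contact i (j + 1) = Fin.last n) (hm : x.malicious i (j + 1) = k) :
    k ∈ active sticky (state α β sticky x (epoch β j)) i ∨
      k ∈ active sticky (state α β sticky x (epoch β (j + 1))) i := by
  have hlt := epoch_lt_succ hβ j
  obtain ⟨t, ht⟩ : ∃ t, epoch β (j + 1) = t + 1 := ⟨epoch β (j + 1) - 1, by omega⟩
  have h1 : epoch β j ≤ t := by omega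
  have h2 : t < epoch β (j + 1) := by omega
  rw [or_iff_not_imp_left, ← active_state_eq hβ i h1 h2]
  intro hk
  rw [ht, state_succ, step, phase_eq hβ h1 h2, if_pos ht.symm]
  have hR (B : Fin n → Fin K) : recommendation x (j + 1) B i = k := by
    rw [recommendation, dif_neg (by simp [hc]), hm]
  refine Finset.mem_union_right _ (Finset.mem_insert_of_mem (Finset.mem_singleton.2 ?_))
  simp only [hR, if_neg hk]

lemma plays_mono (i : Fin n) (k : Fin K) :
    Monotone (fun t => (state α β sticky x t).plays i k) :=
  monotone_nat_of_le_succ fun t => by simp [plays_succ]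

lemma sum_plays (t : ℕ) (i : Fin n) : ∑ k, (state α β sticky x t).plays i k = t := by
  induction t with
  | zero => simp [state, initialState]
  | succ t ih => simp [plays_succ, Finset.sum_add_distrib, ih]

lemma plays_le (t : ℕ) (i : Fin n) (k : Fin K) : (state α β sticky x t).plays i k ≤ t := by
  conv_rhs => rw [← sum_plays (α := α) (β := β) (sticky := sticky) (x := x) t i]
  exact Finset.single_le_sum (f := fun k => (state α β sticky x t).plays i k)
    (fun _ _ => Nat.zero_le _) (Finset.mem_univ k)

lemma regret_eq_sum_plays [NeZero K] (μ : Fin K → unitInterval) (i : Fin n) (T : ℕ) :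
    regret μ α β sticky x i T = ∑ k, gap μ k * (state α β sticky x T).plays i k := by
  induction T with
  | zero => simp [regret, state, initialState]
  | succ T ih =>
    rw [regret, Finset.sum_Icc_succ_top (by omega), ← regret, ih]
    simp [plays_succ, mul_add, Finset.sum_add_distrib]

lemma mem_argmaxSet {ι R : Type*} [LinearOrder R] {s : Finset ι} {f : ι → R} {k : ι} :
    k ∈ argmaxSet s f ↔ k ∈ s ∧ ∀ l ∈ s, f l ≤ f k := by
  simp [argmaxSet]

lemma argmaxSet_nonempty {ι R : Type*} [LinearOrder R] {s : Finset ι} (hs : s.Nonempty)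
    (f : ι → R) : (argmaxSet s f).Nonempty := by
  obtain ⟨k, hk, h⟩ := s.exists_max_image f hs
  exact ⟨k, mem_argmaxSet.2 ⟨hk, h⟩⟩

lemma ucbIndex_le_pull
    (htie : ∀ u i r s, s.Nonempty → x.tie u i r s ∈ s) {t : ℕ} {i : Fin n} {k : Fin K}
    (hk : k ∈ active sticky (state α β sticky x t) i) :
    ucbIndex α x (state α β sticky x t) (t + 1) i k
      ≤ ucbIndex α x (state α β sticky x t) (t + 1) i (pull α β sticky x (t + 1) i) := by
  have h := htie .pull i (t + 1) _ (argmaxSet_nonempty ⟨k, hk⟩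
    (ucbIndex α x (state α β sticky x t) (t + 1) i))
  exact (mem_argmaxSet.1 h).2 k hk

/-- If, between the times `a` and `b`, only arms with at most `M` pulls are pulled, then the
number of time steps is at most `K * (M + 1)`. -/
lemma length_le_of_pulled_plays_le {a b M : ℕ} (hab : a ≤ b) (i : Fin n)
    (h : ∀ t, a ≤ t → t < b →
      (state α β sticky x t).plays i (pull α β sticky x (t + 1) i) ≤ M) :
    b ≤ a + K * (M + 1) := by
  have key (k : Fin K) : (state α β sticky x b).plays i k
      ≤ (state α β sticky x a).plays i k + (M + 1) := by
    -- A pull requires a count of at most `M` beforehand, so it cannot lift the count above `M + 1`.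
    have : (state α β sticky x b).plays i k
        ≤ max ((state α β sticky x a).plays i k) (M + 1) := by
      induction b, hab using Nat.le_induction with
      | base => exact le_max_left _ _
      | succ t hat ih =>
        rw [plays_succ]
        split_ifs with hk
        · have := h t hat (by omega)
          rw [← hk] at this
          omega
        · exact ih fun s h1 h2 => h s h1 (by omega)
    omega
  have hsum := Finset.sum_le_sum fun k (_ : k ∈ Finset.univ) => key k
  simpa [Finset.sum_add_distrib, sum_plays] using hsum

/-- The empirical means of agent `i` after at most `T` pulls of an arm are all accurate up to
`√(log T / s)`, where `s` is the number of pulls. -/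
def Concentrated (μ : Fin K → unitInterval) (x : Randomness n K) (i : Fin n) (T : ℕ) : Prop :=
  ∀ k s, s < T → |∑ l ∈ Finset.range (s + 1), (x.reward i k l - μ k)|
    ≤ √((s + 1 : ℕ) * Real.log T)

lemma Concentrated.abs_empiricalMean_sub_le {μ : Fin K → unitInterval} {i : Fin n} {T : ℕ}
    (h : Concentrated μ x i T) {σ : State n K} {k : Fin K} (h0 : σ.plays i k ≠ 0)
    (hT : σ.plays i k ≤ T) :
    |empiricalMean x σ i k - μ k| ≤ √(Real.log T / σ.plays i k) := by
  obtain ⟨s, hs⟩ := Nat.exists_eq_succ_of_ne_zero h0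
  have h1 := h k s (by omega)
  rw [empiricalMean, hs]
  have hpos : (0 : ℝ) < (s + 1 : ℕ) := by positivity
  have h2 : (∑ l ∈ Finset.range s.succ, x.reward i k l) / (s.succ : ℝ) - μ k
      = (∑ l ∈ Finset.range (s + 1), (x.reward i k l - μ k)) / (s + 1 : ℕ) := by
    rw [Finset.sum_sub_distrib, sub_div]
    simp only [Finset.sum_const, Finset.card_range, nsmul_eq_mul]
    rw [mul_div_cancel_left₀ _ hpos.ne']
  rw [h2, abs_div, abs_of_pos hpos, div_le_iff₀ hpos]
  refine h1.trans_eq ?_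
  rw [Nat.succ_eq_add_one]
  nth_rewrite 3 [← Real.sqrt_sq hpos.le]
  rw [← Real.sqrt_mul' _ (by positivity)]
  congr 1
  field_simp

/-- The exploration bonus is at least `1 + r` units of `√(log T / s)`, where `s` is the number of
pulls. One unit pays for the error of the empirical mean, and the other `r` are worth at least `r Δ
/ q` while `s < q² log T / Δ²`. -/
lemma le_ucbIndex {μ : Fin K → unitInterval} {i : Fin n} {T : ℕ}
    (h : Concentrated μ x i T) {σ : State n K} {k : Fin K} (hT : σ.plays i k ≤ T) {t : ℕ}
    {r q Δ : ℝ} (hr : 0 ≤ r) (hq : 0 < q) (hΔ : 0 < Δ)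
    (hlog : (1 + r) ^ 2 * Real.log T ≤ α * Real.log t)
    (hplays : (σ.plays i k : ℝ) < q ^ 2 * Real.log T / Δ ^ 2) :
    ((μ k + r * Δ / q : ℝ) : EReal) ≤ ucbIndex α x σ t i k := by
  rw [ucbIndex]
  split_ifs with h0
  · exact le_top
  rw [EReal.coe_le_coe_iff]
  have h1 := (abs_le.1 (h.abs_empiricalMean_sub_le h0 hT)).1
  have hpos : (0 : ℝ) < σ.plays i k := by exact_mod_cast Nat.pos_of_ne_zero h0
  have h2 : (1 + r) * √(Real.log T / σ.plays i k) ≤ √(α * Real.log t / σ.plays i k) := by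
    rw [← Real.sqrt_sq (by linarith : 0 ≤ 1 + r), ← Real.sqrt_mul (by positivity)]
    apply Real.sqrt_le_sqrt
    rw [← mul_div_assoc]
    gcongr
  have h3 : Δ / q ≤ √(Real.log T / σ.plays i k) := by
    apply Real.le_sqrt_of_sq_le
    rw [lt_div_iff₀ (by positivity)] at hplays
    rw [div_pow, div_le_div_iff₀ (by positivity) hpos]
    linarith
  have h4 : r * Δ / q ≤ r * √(Real.log T / σ.plays i k) := by
    rw [mul_div_assoc]
    gcongr
  linarith

/-- Error and bonus together are at most `(1 + √α) √(log T / s)` after `s` pulls, so an index that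
exceeds the mean by `δ` forces `s` to be small. -/
lemma le_of_le_ucbIndex {μ : Fin K → unitInterval} {i : Fin n} {T : ℕ} (hα : 0 ≤ α)
    (h : Concentrated μ x i T) {σ : State n K} {k : Fin K} (hT : σ.plays i k ≤ T) {t : ℕ}
    (ht0 : 0 < t) (ht : t ≤ T) {v δ : ℝ} (hδ : 0 < δ) (hv : μ k + δ ≤ v)
    (hle : (v : EReal) ≤ ucbIndex α x σ t i k) :
    (σ.plays i k : ℝ) ≤ ((1 + √α) / δ) ^ 2 * Real.log T := by
  have hTlog : 0 ≤ Real.log T := Real.log_natCast_nonneg T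
  by_cases h0 : σ.plays i k = 0
  · rw [h0, Nat.cast_zero]
    positivity
  rw [ucbIndex, if_neg h0, EReal.coe_le_coe_iff] at hle
  have h1 := (abs_le.1 (h.abs_empiricalMean_sub_le h0 hT)).2
  have hpos : (0 : ℝ) < σ.plays i k := by exact_mod_cast Nat.pos_of_ne_zero h0
  have h2 : √(α * Real.log t / σ.plays i k) ≤ √α * √(Real.log T / σ.plays i k) := by
    rw [← Real.sqrt_mul hα, ← mul_div_assoc]
    gcongr
  have h3 : δ / (1 + √α) ≤ √(Real.log T / σ.plays i k) := by
    rw [div_le_iff₀ (by positivity)]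
    linarith
  have h4 : (δ / (1 + √α)) ^ 2 ≤ Real.log T / σ.plays i k := by
    rw [← Real.sq_sqrt (show 0 ≤ Real.log T / σ.plays i k by positivity)]
    gcongr
  rw [le_div_iff₀ hpos, div_pow, div_mul_eq_mul_div, div_le_iff₀ (by positivity)] at h4
  rw [div_pow, div_mul_eq_mul_div, le_div_iff₀ (by positivity)]
  linarith

/-- If a suboptimal arm is active in a long period on which the empirical means are accurate, then
it has been pulled a logarithmic number of times at the end of this period. -/
lemma le_plays_of_active [NeZero K] {μ : Fin K → unitInterval} {i : Fin n} {T a b : ℕ}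
    (htie : ∀ u i r s, s.Nonempty → x.tie u i r s ∈ s) (hanti : Antitone μ)
    (hα : 0 ≤ α) (h : Concentrated μ x i T) (hab : a ≤ b) (hbT : b ≤ T) {k : Fin K}
    (hk : ∀ t, a ≤ t → t < b → k ∈ active sticky (state α β sticky x t) i)
    (hgap : 0 < gap μ k) {r q : ℝ} (hq : 0 < q) (hqr : q < r)
    (hlog : ∀ t, a < t → (1 + r) ^ 2 * Real.log T ≤ α * Real.log t)
    (hlong : K * (((1 + √α) / (gap μ k * (r / q - 1))) ^ 2 * Real.log T + 1) < (b - a : ℝ)) :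
    q ^ 2 * Real.log T / gap μ k ^ 2 ≤ (state α β sticky x b).plays i k := by
  by_contra! hlt
  set C : ℝ := ((1 + √α) / (gap μ k * (r / q - 1))) ^ 2 * Real.log T
  have hC : 0 ≤ C := by positivity
  have hδ : 0 < gap μ k * (r / q - 1) :=
    mul_pos hgap (sub_pos.2 ((one_lt_div hq).2 hqr))
  -- While `k` is underplayed, its index is at least `μ 0 + δ` with `δ = gap μ k * (r / q - 1)`. The
  -- pulled arm has at least this index and mean at most `μ 0`, hence at most `C` pulls.
  have key := length_le_of_pulled_plays_le (α := α) (β := β) (sticky := sticky) (x := x)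
    (M := ⌊C⌋₊) hab i fun t h1 h2 => by
      apply Nat.le_floor
      refine le_of_le_ucbIndex hα h ((plays_le _ _ _).trans (by omega)) (Nat.succ_pos t)
        (by omega) hδ (v := μ k + r * gap μ k / q) ?_
        ((le_ucbIndex h ((plays_le _ _ _).trans (by omega)) (by linarith) hq hgap
          (hlog (t + 1) (by omega)) (lt_of_le_of_lt ?_ hlt)).trans
          (ucbIndex_le_pull htie (hk t h1 h2)))
      · have h3 : (μ (pull α β sticky x (t + 1) i) : ℝ) ≤ μ 0 := hanti (Fin.zero_le _)
        have h4 : gap μ k * (r / q - 1) = r * gap μ k / q - (μ 0 - μ k) := by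
          rw [gap]; ring
        linarith
      · exact_mod_cast plays_mono i k h2.le
  have h5 : (b : ℝ) ≤ a + K * (⌊C⌋₊ + 1) := by exact_mod_cast key
  have h6 : (K : ℝ) * (⌊C⌋₊ + 1) ≤ K * (C + 1) := by
    gcongr
    exact Nat.floor_le hC
  linarith

/-- A malicious recommendation of a suboptimal arm in a late phase forces a logarithmic number of
pulls of this arm. -/
lemma le_plays_of_malicious [NeZero K] {μ : Fin K → unitInterval} {i : Fin n} {T j J : ℕ}
    (htie : ∀ u i r s, s.Nonempty → x.tie u i r s ∈ s) (hanti : Antitone μ)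
    (hα : 0 ≤ α) (hβ : 1 < β) (h : Concentrated μ x i T) (hJ : J ≤ j)
    (hjT : epoch β (j + 2) ≤ T) {k : Fin K}
    (hc : x.contact i (j + 1) = Fin.last n) (hm : x.malicious i (j + 1) = k)
    (hgap : 0 < gap μ k) {r q : ℝ} (hq : 0 < q) (hqr : q < r)
    (hlog : ∀ t, epoch β J < t → (1 + r) ^ 2 * Real.log T ≤ α * Real.log t)
    (hlong : K * (((1 + √α) / (gap μ k * (r / q - 1))) ^ 2 * Real.log T + 1)
      < (J : ℝ) ^ (β - 1) - 1) :
    q ^ 2 * Real.log T / gap μ k ^ 2 ≤ (state α β sticky x T).plays i k := by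
  -- Needed for `l = j` and for `l = j + 1`, the two phases in which the recommended arm may be
  -- active.
  have key (l : ℕ) (hl : J ≤ l) (hlT : epoch β (l + 1) ≤ T)
      (hkl : k ∈ active sticky (state α β sticky x (epoch β l)) i) :
      q ^ 2 * Real.log T / gap μ k ^ 2 ≤ (state α β sticky x T).plays i k := by
    refine (le_plays_of_active htie hanti hα h (epoch_lt_succ hβ l).le hlT
      (fun t h1 h2 => by rwa [active_state_eq hβ i h1 h2]) hgap hq hqr
      (fun t ht => hlog t (((epoch_strictMono hβ).monotone hl).trans_lt ht))
      (hlong.trans_le ?_)).trans (by exact_mod_cast plays_mono i k hlT)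
    have h1 : (J : ℝ) ^ (β - 1) ≤ ((l : ℝ) + 1) ^ (β - 1) :=
      Real.rpow_le_rpow J.cast_nonneg (by exact_mod_cast hl.trans (Nat.le_succ l))
        (by linarith)
    linarith [epoch_add_rpow_le hβ l]
  rcases mem_active_of_malicious (α := α) (sticky := sticky) hβ hc hm with hk | hk
  · exact key j hJ ((epoch_lt_succ hβ (j + 1)).le.trans hjT) hk
  · exact key (j + 1) (by omega) hjT hk

end Dynamics

/-! ### Concentration of rewards and frequency of malicious recommendations. -/

section Probability

variable {Ω : Type*} [MeasurableSpace Ω] {P : Measure Ω}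
  {n K : ℕ} {μ : Fin K → unitInterval} {sticky : Fin n → Finset (Fin K)}
  {ξ : Ω → Randomness n K}

lemma IsModel.integral_reward (hξ : IsModel P μ sticky ξ) (i : Fin n) (k : Fin K) (s : ℕ) :
    ∫ ω, (ξ ω).reward i k s ∂P = μ k := by
  rw [← integral_map (φ := fun ω => (ξ ω).reward i k s) (f := fun y => y)
    (hξ.measurable_reward i k s).aemeasurable (by fun_prop), hξ.law_reward,
    integral_bernoulliMeasure]
  simp

lemma IsModel.reward_mem_Icc (hξ : IsModel P μ sticky ξ) (i : Fin n) (k : Fin K) (s : ℕ) :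
    ∀ᵐ ω ∂P, (ξ ω).reward i k s ∈ Set.Icc (0 : ℝ) 1 := by
  rw [← ae_map_iff (p := fun y => y ∈ Set.Icc (0 : ℝ) 1)
    (hξ.measurable_reward i k s).aemeasurable measurableSet_Icc, hξ.law_reward, ae_iff]
  exact bernoulliMeasure_apply_of_notMem_of_notMem _ (by measurability) (by simp) (by simp)

lemma IsModel.hasSubgaussianMGF_reward [IsProbabilityMeasure P]
    (hξ : IsModel P μ sticky ξ) (i : Fin n) (k : Fin K)
    (s : ℕ) : HasSubgaussianMGF (fun ω => (ξ ω).reward i k s - μ k) (1 / 4) P := by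
  have h := hasSubgaussianMGF_of_mem_Icc (hξ.measurable_reward i k s).aemeasurable
    (hξ.reward_mem_Icc i k s)
  rw [hξ.integral_reward] at h
  convert h using 1
  norm_num [div_pow]

lemma IsModel.iIndepFun_reward (hξ : IsModel P μ sticky ξ) (i : Fin n) (k : Fin K) :
    iIndepFun (fun s ω => (ξ ω).reward i k s - μ k) P := by
  have h : iIndepFun (fun s ω => (ξ ω).reward i k s) P :=
    hξ.indep.precomp (g := fun s => Source.reward i k s) fun s s' h => by cases h; rfl
  exact h.comp (fun _ y => y - (μ k : ℝ)) fun _ => by fun_prop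

/-- The radius `√(s log T)` is chosen to make the Hoeffding exponent equal to `-2 log T` whatever
the number `s` of samples. -/
lemma exp_hoeffding {T : ℕ} (hT : 0 < T) (s : ℕ) :
    Real.exp (-√((s + 1 : ℕ) * Real.log T) ^ 2 / (2 * (s + 1 : ℕ) * ((1 / 4 : NNReal) : ℝ)))
      = 1 / (T : ℝ) ^ 2 := by
  have h1 : -√((s + 1 : ℕ) * Real.log T) ^ 2 / (2 * (s + 1 : ℕ) * ((1 / 4 : NNReal) : ℝ))
      = -(2 * Real.log T) := by
    rw [Real.sq_sqrt (mul_nonneg (Nat.cast_nonneg _) (Real.log_natCast_nonneg T))]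
    push_cast
    field_simp
    norm_num
  rw [h1, Real.exp_neg, two_mul, Real.exp_add, Real.exp_log (by exact_mod_cast hT)]
  field_simp

lemma IsModel.measureReal_lt_abs_sum_le [IsProbabilityMeasure P]
    (hξ : IsModel P μ sticky ξ) (i : Fin n) (k : Fin K)
    {T : ℕ} (hT : 0 < T) (s : ℕ) :
    P.real {ω | √((s + 1 : ℕ) * Real.log T)
      < |∑ l ∈ Finset.range (s + 1), ((ξ ω).reward i k l - μ k)|} ≤ 2 / (T : ℝ) ^ 2 := by
  have h1 := HasSubgaussianMGF.measure_sum_range_ge_le_of_iIndepFun (n := s + 1)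
    (hξ.iIndepFun_reward i k) (fun l _ => hξ.hasSubgaussianMGF_reward i k l)
    (Real.sqrt_nonneg ((s + 1 : ℕ) * Real.log T))
  have h2 := HasSubgaussianMGF.measure_sum_range_ge_le_of_iIndepFun (n := s + 1)
    (X := fun l ω => -((ξ ω).reward i k l - μ k))
    ((hξ.iIndepFun_reward i k).comp (fun _ y => -y) fun _ => measurable_neg)
    (fun l _ => (hξ.hasSubgaussianMGF_reward i k l).neg)
    (Real.sqrt_nonneg ((s + 1 : ℕ) * Real.log T))
  rw [exp_hoeffding hT] at h1 h2
  refine (measureReal_mono (fun ω hω => ?_)).trans ((measureReal_union_le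
    {ω | √((s + 1 : ℕ) * Real.log T)
      ≤ ∑ l ∈ Finset.range (s + 1), ((ξ ω).reward i k l - μ k)}
    {ω | √((s + 1 : ℕ) * Real.log T)
      ≤ ∑ l ∈ Finset.range (s + 1), -((ξ ω).reward i k l - μ k)}).trans ?_)
  · rcases lt_abs.1 (Set.mem_ofPred_eq ▸ hω) with h | h
    · exact Or.inl h.le
    · exact Or.inr (by simpa only [Set.mem_ofPred_eq, Finset.sum_neg_distrib] using h.le)
  · have h3 : 2 / (T : ℝ) ^ 2 = 1 / (T : ℝ) ^ 2 + 1 / (T : ℝ) ^ 2 := by ring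
    linarith

/-- Union bound over `K` arms and `T` sample sizes, each failing with probability at most `2 / T²`:
the total `2 K / T` vanishes. -/
lemma IsModel.tendsto_measureReal_not_concentrated [IsProbabilityMeasure P]
    (hξ : IsModel P μ sticky ξ) (i : Fin n) :
    Tendsto (fun T : ℕ => P.real {ω | ¬ Concentrated μ (ξ ω) i T}) atTop (𝓝 0) := by
  have hlim : Tendsto (fun T : ℕ => 2 * K / (T : ℝ)) atTop (𝓝 0) :=
    tendsto_const_div_atTop_nhds_zero_nat _
  refine tendsto_of_tendsto_of_tendsto_of_le_of_le' tendsto_const_nhds hlim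
    (Eventually.of_forall fun T => measureReal_nonneg) ?_
  filter_upwards [eventually_gt_atTop 0] with T hT
  have hset : {ω | ¬ Concentrated μ (ξ ω) i T} = ⋃ k ∈ (Finset.univ : Finset (Fin K)),
      ⋃ s ∈ Finset.range T, {ω | √((s + 1 : ℕ) * Real.log T)
        < |∑ l ∈ Finset.range (s + 1), ((ξ ω).reward i k l - μ k)|} := by
    ext ω
    simp [Concentrated]
  rw [hset]
  refine (measureReal_biUnion_finset_le _ _).trans ((Finset.sum_le_sum fun k _ =>
    (measureReal_biUnion_finset_le _ _).trans (Finset.sum_le_sum fun s _ =>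
      hξ.measureReal_lt_abs_sum_le i k hT s)).trans_eq ?_)
  simp only [Finset.sum_const, Finset.card_univ, Finset.card_range, Fintype.card_fin,
    nsmul_eq_mul]
  field_simp

/-- The event that the malicious agent recommends arm `k` to agent `i` in phase `j`. -/
def maliciousEvent (ξ : Ω → Randomness n K) (i : Fin n) (k : Fin K) (j : ℕ) : Set Ω :=
  {ω | (ξ ω).contact i j = Fin.last n ∧ (ξ ω).malicious i j = k}

lemma IsModel.measureReal_contact (hξ : IsModel P μ sticky ξ) (i : Fin n) (j : ℕ) :
    P.real {ω | (ξ ω).contact i j = Fin.last n} = 1 / n := by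
  have h : P {ω | (ξ ω).contact i j = Fin.last n}
      = P.map (fun ω => (ξ ω).contact i j) {Fin.last n} :=
    (Measure.map_apply (hξ.measurable_contact i j) (measurableSet_singleton _)).symm
  have h1 : {c : Fin (n + 1) | c ≠ i.castSucc}
      = ((Finset.univ.erase i.castSucc : Finset (Fin (n + 1))) : Set (Fin (n + 1))) := by
    ext; simp
  have h2 : Fin.last n ∈ Finset.univ.erase i.castSucc := by
    simp [(Fin.castSucc_lt_last i).ne']
  rw [measureReal_def, h, hξ.law_contact, h1, ← Finset.coe_singleton, uniformOn_apply_finset,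
    Finset.inter_singleton_of_mem h2]
  simp

lemma IsModel.measureReal_malicious (hξ : IsModel P μ sticky ξ) (i : Fin n) (j : ℕ)
    (k : Fin K) : P.real {ω | (ξ ω).malicious i j = k} = 1 / K := by
  have h : P {ω | (ξ ω).malicious i j = k} = P.map (fun ω => (ξ ω).malicious i j) {k} :=
    (Measure.map_apply (hξ.measurable_malicious i j) (measurableSet_singleton _)).symm
  rw [measureReal_def, h, hξ.law_malicious, uniformOn_univ]
  simp

lemma measurableSet_contact {Ω : Type*} {ξ : Ω → Randomness n K} (i : Fin n) (j : ℕ) :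
    MeasurableSet[Source.sigmaAlgebra ξ (.contact i j)] {ω | (ξ ω).contact i j = Fin.last n} :=
  ⟨{Fin.last n}, measurableSet_singleton _, rfl⟩

lemma measurableSet_malicious {Ω : Type*} {ξ : Ω → Randomness n K} (i : Fin n)
    (j : ℕ) (k : Fin K) :
    MeasurableSet[Source.sigmaAlgebra ξ (.malicious i j)] {ω | (ξ ω).malicious i j = k} :=
  ⟨{k}, measurableSet_singleton _, rfl⟩

lemma IsModel.sigmaAlgebra_le (hξ : IsModel P μ sticky ξ) (s : Source n K) :
    Source.sigmaAlgebra ξ s ≤ ‹MeasurableSpace Ω› := by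
  cases s with
  | reward i k s => exact (hξ.measurable_reward i k s).comap_le
  | contact i j => exact (hξ.measurable_contact i j).comap_le
  | malicious i j => exact (hξ.measurable_malicious i j).comap_le

lemma IsModel.measureReal_maliciousEvent (hξ : IsModel P μ sticky ξ) (i : Fin n) (k : Fin K)
    (j : ℕ) : P.real (maliciousEvent ξ i k j) = 1 / n * (1 / K) := by
  have h := (Indep_iff _ _ _).1
    (hξ.indep.indep (i := .contact i j) (j := .malicious i j) (by simp)) _ _
    (measurableSet_contact i j) (measurableSet_malicious i j k)
  rw [← hξ.measureReal_contact i j, ← hξ.measureReal_malicious i j k, measureReal_def,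
    measureReal_def, measureReal_def, ← ENNReal.toReal_mul, ← h]
  rfl

/-- The labels of the random variables that govern the recommendations of the malicious agent to
agent `i` in the phases in `s`. -/
def phaseSources (K : ℕ) (i : Fin n) (s : Set ℕ) : Set (Source n K) :=
  {z | ∃ j ∈ s, z = .contact i j ∨ z = .malicious i j}

lemma measurableSet_maliciousEvent {Ω : Type*} {ξ : Ω → Randomness n K} (i : Fin n)
    (k : Fin K) {j : ℕ} {s : Set ℕ} (hj : j ∈ s) :
    MeasurableSet[⨆ z ∈ phaseSources K i s, Source.sigmaAlgebra ξ z]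
      (maliciousEvent ξ i k j) := by
  refine MeasurableSet.inter ?_ ?_
  · exact le_iSup₂ (f := fun z (_ : z ∈ phaseSources K i s) => Source.sigmaAlgebra ξ z)
      (.contact i j) ⟨j, hj, Or.inl rfl⟩ _ (measurableSet_contact i j)
  · exact le_iSup₂ (f := fun z (_ : z ∈ phaseSources K i s) => Source.sigmaAlgebra ξ z)
      (.malicious i j) ⟨j, hj, Or.inr rfl⟩ _ (measurableSet_malicious i j k)

lemma disjoint_phaseSources (i : Fin n) {s t : Set ℕ} (h : Disjoint s t) :
    Disjoint (phaseSources K i s) (phaseSources K i t) := by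
  rw [Set.disjoint_left] at h ⊢
  rintro _ ⟨j, hj, rfl | rfl⟩ ⟨l, hl, h1 | h1⟩ <;> cases h1 <;> exact h hj hl

/-- Distinct phases depend on disjoint families of independent sources, so the probabilities of no
recommendation multiply. -/
lemma IsModel.measureReal_iInter_maliciousEvent_compl [IsProbabilityMeasure P]
    (hξ : IsModel P μ sticky ξ) (i : Fin n)
    (k : Fin K) (J W : ℕ) :
    P.real (⋂ l ∈ Finset.range W, (maliciousEvent ξ i k (J + l))ᶜ)
      = (1 - 1 / n * (1 / K)) ^ W := by
  induction W with
  | zero => simp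
  | succ W ih =>
    have hI : Indep _ _ P := indep_iSup_of_disjoint hξ.sigmaAlgebra_le hξ.indep
      (disjoint_phaseSources (K := K) i
        (Set.disjoint_singleton_right.2 (by simp) : Disjoint (Set.Iio (J + W)) {J + W}))
    have hm : MeasurableSet (maliciousEvent ξ i k (J + W)) :=
      (iSup₂_le fun z _ => hξ.sigmaAlgebra_le z) _
        (measurableSet_maliciousEvent i k (Set.mem_singleton _))
    have h := (Indep_iff _ _ _).1 hI
      (⋂ l ∈ Finset.range W, (maliciousEvent ξ i k (J + l))ᶜ)
      (maliciousEvent ξ i k (J + W))ᶜ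
      (Finset.measurableSet_biInter _ fun l hl => (measurableSet_maliciousEvent i k
        (by have := Finset.mem_range.1 hl; simp [this])).compl)
      (measurableSet_maliciousEvent i k (Set.mem_singleton _)).compl
    rw [Finset.range_add_one, Finset.set_biInter_insert, Set.inter_comm, measureReal_def, h,
      ENNReal.toReal_mul, ← measureReal_def, ← measureReal_def, ih,
      probReal_compl_eq_one_sub hm, hξ.measureReal_maliciousEvent, pow_succ]

end Probability

/-! ### Measurability of the algorithm, needed for the integrability of the regret. -/

section Measurability

variable {Ω : Type*} [MeasurableSpace Ω]

/-- Random pull counts, phases, contacts and argmax sets enter as indices with countably many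
values, so one can split over the value. -/
lemma measurable_apply_of_countable {ι γ : Type*} [Countable ι] [MeasurableSpace γ]
    {f : ι → Ω → γ} {g : Ω → ι} (hf : ∀ y, Measurable (f y))
    (hg : ∀ y, MeasurableSet {ω | g ω = y}) : Measurable (fun ω => f (g ω) ω) := by
  intro s hs
  have : (fun ω => f (g ω) ω) ⁻¹' s = ⋃ y, {ω | g ω = y} ∩ f y ⁻¹' s := by
    ext ω; simp
  rw [this]
  exact MeasurableSet.iUnion fun y => (hg y).inter (hf y hs)

lemma measurable_ite {γ : Type*} [MeasurableSpace γ] {p : Ω → Prop} [DecidablePred p]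
    {f g : Ω → γ} (hp : MeasurableSet {ω | p ω}) (hf : Measurable f) (hg : Measurable g) :
    Measurable (fun ω => if p ω then f ω else g ω) :=
  Measurable.ite hp hf hg

lemma measurableSet_eq_of_measurableSet_mem {κ : Type*} [Fintype κ] {S : Ω → Finset κ}
    (hS : ∀ k, MeasurableSet {ω | k ∈ S ω}) (s : Finset κ) : MeasurableSet {ω | S ω = s} := by
  have : {ω | S ω = s} = ⋂ k, {ω | k ∈ S ω ↔ k ∈ s} := by
    ext ω; simp [Finset.ext_iff]
  rw [this]
  refine MeasurableSet.iInter fun k => ?_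
  by_cases hk : k ∈ s
  · simpa [hk] using hS k
  · simp only [hk, iff_false]
    exact (hS k).compl

lemma measurableSet_apply_mem {κ : Type*} [Countable κ] [MeasurableSpace κ]
    [MeasurableSingletonClass κ] {S : Ω → Finset κ} {g : Ω → κ} (hg : Measurable g)
    (hS : ∀ k, MeasurableSet {ω | k ∈ S ω}) : MeasurableSet {ω | g ω ∈ S ω} := by
  have : {ω | g ω ∈ S ω} = ⋃ k, {ω | g ω = k} ∩ {ω | k ∈ S ω} := by
    ext ω; simp
  rw [this]
  exact MeasurableSet.iUnion fun k => (hg (measurableSet_singleton k)).inter (hS k)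

lemma measurableSet_mem_argmaxSet {κ R : Type*} [Fintype κ] [LinearOrder R]
    [TopologicalSpace R] [OrderClosedTopology R] [SecondCountableTopology R] [MeasurableSpace R]
    [OpensMeasurableSpace R] {S : Ω → Finset κ} {f : Ω → κ → R}
    (hS : ∀ k, MeasurableSet {ω | k ∈ S ω}) (hf : ∀ k, Measurable (fun ω => f ω k)) (k : κ) :
    MeasurableSet {ω | k ∈ argmaxSet (S ω) (f ω)} := by
  have : {ω | k ∈ argmaxSet (S ω) (f ω)}
      = {ω | k ∈ S ω} ∩ ⋂ l, ({ω | l ∈ S ω}ᶜ ∪ {ω | f ω l ≤ f ω k}) := by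
    ext ω; simp [mem_argmaxSet, imp_iff_not_or]
  rw [this]
  exact (hS k).inter (MeasurableSet.iInter fun l =>
    (hS l).compl.union (measurableSet_le (hf l) (hf k)))

/-- All the components of a random state are measurable. -/
structure MeasurableState {n K : ℕ} (σ : Ω → State n K) : Prop where
  phase : Measurable (fun ω => (σ ω).phase)
  plays : ∀ i k, Measurable (fun ω => (σ ω).plays i k)
  epochPlays : ∀ i k, Measurable (fun ω => (σ ω).epochPlays i k)
  U : ∀ i, Measurable (fun ω => (σ ω).U i)
  L : ∀ i, Measurable (fun ω => (σ ω).L i)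

variable {P : Measure Ω} {n K : ℕ} {μ : Fin K → unitInterval} {α β : ℝ}
  {sticky : Fin n → Finset (Fin K)} {ξ : Ω → Randomness n K} {σ : Ω → State n K}

lemma IsModel.measurable_tie_argmaxSet (hξ : IsModel P μ sticky ξ) (u : ArgmaxUse) (i : Fin n)
    {R : Type*} [LinearOrder R] [TopologicalSpace R] [OrderClosedTopology R]
    [SecondCountableTopology R] [MeasurableSpace R] [OpensMeasurableSpace R]
    {r : Ω → ℕ} (hr : Measurable r) {S : Ω → Finset (Fin K)} {f : Ω → Fin K → R}
    (hS : ∀ k, MeasurableSet {ω | k ∈ S ω}) (hf : ∀ k, Measurable (fun ω => f ω k)) :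
    Measurable (fun ω => (ξ ω).tie u i (r ω) (argmaxSet (S ω) (f ω))) :=
  measurable_apply_of_countable (f := fun s ω => (ξ ω).tie u i (r ω) s)
    (fun s => measurable_apply_of_countable (f := fun l ω => (ξ ω).tie u i l s)
      (fun l => hξ.measurable_tie u i l s) fun y => hr (measurableSet_singleton y))
    (measurableSet_eq_of_measurableSet_mem (measurableSet_mem_argmaxSet hS hf))

lemma MeasurableState.measurableSet_mem_active (hσ : MeasurableState σ) (i : Fin n)
    (k : Fin K) : MeasurableSet {ω | k ∈ active sticky (σ ω) i} := by
  have : {ω | k ∈ active sticky (σ ω) i}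
      = {_ω | k ∈ sticky i} ∪ ({ω | (σ ω).U i = k} ∪ {ω | (σ ω).L i = k}) := by
    ext ω; simp [active, eq_comm, or_comm, or_left_comm]
  rw [this]
  exact (MeasurableSet.const _).union ((hσ.U i (measurableSet_singleton k)).union
    (hσ.L i (measurableSet_singleton k)))

lemma IsModel.measurable_ucbIndex (hξ : IsModel P μ sticky ξ) (hσ : MeasurableState σ) (t : ℕ)
    (i : Fin n) (k : Fin K) : Measurable (fun ω => ucbIndex α (ξ ω) (σ ω) t i k) := by
  refine measurable_apply_of_countable (g := fun ω => (σ ω).plays i k)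
    (f := fun m ω => if m = 0 then (⊤ : EReal) else
      (((∑ s ∈ Finset.range m, (ξ ω).reward i k s) / (m : ℝ)
        + √(α * Real.log (t : ℝ) / (m : ℝ)) : ℝ) : EReal)) (fun m => ?_)
    fun y => hσ.plays i k (measurableSet_singleton y)
  by_cases hm : m = 0
  · simp [hm]
  · simp only [hm, if_false]
    exact ((((Finset.measurable_sum _ fun s _ => hξ.measurable_reward i k s).div_const _).add_const
      _)).coe_real_ereal

lemma IsModel.measurable_pullFrom (hξ : IsModel P μ sticky ξ) (hσ : MeasurableState σ) (t : ℕ)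
    (i : Fin n) : Measurable (fun ω => pullFrom α sticky (ξ ω) t (σ ω) i) :=
  hξ.measurable_tie_argmaxSet .pull i measurable_const (hσ.measurableSet_mem_active i)
    (hξ.measurable_ucbIndex hσ t i)

lemma IsModel.measurable_recommendation (hξ : IsModel P μ sticky ξ) {r : Ω → ℕ}
    (hr : Measurable r) {B : Ω → Fin n → Fin K} (hB : ∀ i, Measurable (fun ω => B ω i))
    (i : Fin n) : Measurable (fun ω => recommendation (ξ ω) (r ω) (B ω) i) := by
  refine measurable_apply_of_countable (g := r)
    (f := fun j ω => recommendation (ξ ω) j (B ω) i) (fun j => ?_)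
    fun y => hr (measurableSet_singleton y)
  refine measurable_apply_of_countable (ι := Fin (n + 1))
    (g := fun ω => (ξ ω).contact i j)
    (f := fun c ω => if h : (c : ℕ) < n then B ω ⟨c, h⟩ else (ξ ω).malicious i j) (fun c => ?_)
    fun y => hξ.measurable_contact i j (measurableSet_singleton y)
  by_cases hc : (c : ℕ) < n
  · simpa [hc] using hB ⟨c, hc⟩
  · simpa [hc] using hξ.measurable_malicious i j

lemma IsModel.measurableState_step (hξ : IsModel P μ sticky ξ) (hσ : MeasurableState σ)
    (t : ℕ) : MeasurableState (fun ω => step α β sticky (ξ ω) t (σ ω)) := by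
  have hN (i : Fin n) (k : Fin K) : Measurable (fun ω => (σ ω).plays i k
      + if k = pullFrom α sticky (ξ ω) t (σ ω) i then 1 else 0) :=
    (hσ.plays i k).add ((measurable_of_countable fun l => if k = l then 1 else 0).comp
      (hξ.measurable_pullFrom hσ t i))
  have hD (i : Fin n) (k : Fin K) := (hN i k).sub (hσ.epochPlays i k)
  have hB (i : Fin n) := hξ.measurable_tie_argmaxSet .mostPlayed i hσ.phase
    (hσ.measurableSet_mem_active (sticky := sticky) i) (hD i)
  have hR (i : Fin n) := hξ.measurable_recommendation hσ.phase hB i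
  have hmem (i : Fin n) :=
    measurableSet_apply_mem (hR i) (hσ.measurableSet_mem_active (sticky := sticky) i)
  have hkeep (i : Fin n) := hξ.measurable_tie_argmaxSet .keep i hσ.phase
    (S := fun ω => {(σ ω).U i, (σ ω).L i}) (fun k => by
      have := (hσ.U i (measurableSet_singleton k)).union (hσ.L i (measurableSet_singleton k))
      convert this using 1
      ext ω; simp [eq_comm]) (hD i)
  have hE : MeasurableSet {ω | t = epoch β (σ ω).phase} :=
    hσ.phase (MeasurableSet.of_discrete (s := {j | t = epoch β j}))
  constructor
  · have h := measurable_ite hE (hσ.phase.add_const 1) hσ.phase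
    convert h using 2
    rw [step]; split_ifs <;> rfl
  · intro i k
    convert hN i k using 2 with ω
    by_cases h : t = epoch β (σ ω).phase
    · rw [step, if_pos h]
    · rw [step, if_neg h]
  · intro i k
    have h := measurable_ite hE (hN i k) (hσ.epochPlays i k)
    convert h using 2 with ω
    by_cases h : t = epoch β (σ ω).phase
    · rw [step, if_pos h, if_pos h]
    · rw [step, if_neg h, if_neg h]
  · intro i
    have h := measurable_ite hE (measurable_ite (hmem i) (hσ.U i) (hkeep i)) (hσ.U i)
    convert h using 2 with ω
    by_cases h : t = epoch β (σ ω).phase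
    · rw [step, if_pos h, if_pos h]
      rfl
    · rw [step, if_neg h, if_neg h]
  · intro i
    have h := measurable_ite hE (measurable_ite (hmem i) (hσ.L i) (hR i)) (hσ.L i)
    convert h using 2 with ω
    by_cases h : t = epoch β (σ ω).phase
    · rw [step, if_pos h, if_pos h]
      rfl
    · rw [step, if_neg h, if_neg h]

lemma IsModel.measurableState_state (hξ : IsModel P μ sticky ξ) (t : ℕ) :
    MeasurableState (fun ω => state α β sticky (ξ ω) t) := by
  induction t with
  | zero => exact ⟨measurable_const, fun _ _ => measurable_const, fun _ _ => measurable_const,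
      hξ.measurable_initU, hξ.measurable_initL⟩
  | succ t ih => exact hξ.measurableState_step ih (t + 1)

lemma IsModel.measurable_regret [NeZero K] (hξ : IsModel P μ sticky ξ) (i : Fin n) (T : ℕ) :
    Measurable (fun ω => regret μ α β sticky (ξ ω) i T) := by
  simp only [regret_eq_sum_plays]
  exact Finset.measurable_sum _ fun k _ => (measurable_of_countable
    (fun m : ℕ => gap μ k * (m : ℝ))).comp ((hξ.measurableState_state T).plays i k)

lemma regret_nonneg [NeZero K] (hanti : Antitone μ) (x : Randomness n K) (i : Fin n) (T : ℕ) :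
    0 ≤ regret μ α β sticky x i T :=
  Finset.sum_nonneg fun _ _ => sub_nonneg.2 (hanti (Fin.zero_le _))

lemma regret_le [NeZero K] (x : Randomness n K) (i : Fin n) (T : ℕ) :
    regret μ α β sticky x i T ≤ T := by
  refine (Finset.sum_le_card_nsmul _ _ 1 fun t _ => ?_).trans_eq (by simp)
  rw [gap]
  linarith [(μ 0).2.2, (μ (pull α β sticky x t i)).2.1]

lemma IsModel.integrable_regret [NeZero K] [IsFiniteMeasure P] (hξ : IsModel P μ sticky ξ)
    (hanti : Antitone μ) (i : Fin n) (T : ℕ) :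
    Integrable (fun ω => regret μ α β sticky (ξ ω) i T) P :=
  Integrable.of_mem_Icc 0 T (hξ.measurable_regret i T).aemeasurable
    (Eventually.of_forall fun _ => ⟨regret_nonneg hanti _ i T, regret_le _ i T⟩)

end Measurability

/-! ### The window of late phases for a given horizon. -/

/-- The first phase of the window of late phases for the horizon `T`. -/
noncomputable def windowStart (β ρ : ℝ) (T : ℕ) : ℕ := ⌈(T : ℝ) ^ (ρ / β)⌉₊

/-- The number of phases in the window of late phases for the horizon `T`. -/
noncomputable def windowLength (β ρ : ℝ) (T : ℕ) : ℕ :=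
  ⌊(T : ℝ) ^ (1 / β)⌋₊ - 2 - windowStart β ρ T

lemma tendsto_windowLength {β ρ : ℝ} (hβ : 0 < β) (hρ0 : 0 < ρ) (hρ1 : ρ < 1) :
    Tendsto (windowLength β ρ) atTop atTop := by
  have h1 : Tendsto (fun T : ℕ => (T : ℝ) ^ (ρ / β)) atTop atTop :=
    (tendsto_rpow_atTop (by positivity)).comp tendsto_natCast_atTop_atTop
  have h2 : Tendsto (fun T : ℕ => (T : ℝ) ^ ((1 - ρ) / β)) atTop atTop :=
    (tendsto_rpow_atTop (div_pos (by linarith) hβ)).comp tendsto_natCast_atTop_atTop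
  -- The 4 collects the floor, the ceiling and the two phases removed in `windowLength`.
  have h3 : Tendsto (fun T : ℕ => (T : ℝ) ^ (ρ / β) * ((T : ℝ) ^ ((1 - ρ) / β) - 1) - 4)
      atTop atTop :=
    tendsto_atTop_add_const_right _ _
      (h1.atTop_mul_atTop₀ (tendsto_atTop_add_const_right _ _ h2))
  rw [← tendsto_natCast_atTop_iff (R := ℝ)]
  refine tendsto_atTop_mono' _ ?_ h3
  filter_upwards [eventually_gt_atTop 0] with T hT
  have hT' : (0 : ℝ) < T := by exact_mod_cast hT
  have h4 : (T : ℝ) ^ (1 / β) = (T : ℝ) ^ (ρ / β) * (T : ℝ) ^ ((1 - ρ) / β) := by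
    rw [← Real.rpow_add hT']
    congr 1
    ring
  have h5 : (T : ℝ) ^ (1 / β) < ⌊(T : ℝ) ^ (1 / β)⌋₊ + 1 := Nat.lt_floor_add_one _
  have h6 : (windowStart β ρ T : ℝ) < (T : ℝ) ^ (ρ / β) + 1 :=
    Nat.ceil_lt_add_one (by positivity)
  have h7 : (⌊(T : ℝ) ^ (1 / β)⌋₊ : ℝ) ≤ windowLength β ρ T + 2 + windowStart β ρ T := by
    have : ⌊(T : ℝ) ^ (1 / β)⌋₊ ≤ windowLength β ρ T + 2 + windowStart β ρ T := by
      rw [windowLength]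
      omega
    exact_mod_cast this
  rw [mul_sub, ← h4]
  linarith

/-- The two phases removed in `windowLength` ensure that both candidate phases of
`le_plays_of_malicious` end by time `T`. -/
lemma epoch_le_of_lt_windowLength {β ρ : ℝ} (hβ : 0 < β) {T l : ℕ}
    (hl : l < windowLength β ρ T) : epoch β (windowStart β ρ T + l + 2) ≤ T := by
  have h1 : windowStart β ρ T + l + 2 ≤ ⌊(T : ℝ) ^ (1 / β)⌋₊ := by
    rw [windowLength] at hl
    omega
  rw [epoch, Nat.ceil_le]
  calc ((windowStart β ρ T + l + 2 : ℕ) : ℝ) ^ β ≤ ((T : ℝ) ^ (1 / β)) ^ β := by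
        gcongr
        exact (Nat.cast_le.2 h1).trans (Nat.floor_le (by positivity))
    _ = T := by
        rw [← Real.rpow_mul (by positivity), one_div_mul_cancel hβ.ne', Real.rpow_one]

/-- The window starts after time `T ^ ρ`, so passing from `log T` to `log t` costs only the factor
`ρ`. -/
lemma mul_log_le_log_of_epoch_windowStart_lt {β ρ : ℝ} (hβ : 0 < β) {T t : ℕ} (hT : 0 < T)
    (ht : epoch β (windowStart β ρ T) < t) : ρ * Real.log T ≤ Real.log t := by
  have hT' : (0 : ℝ) < T := by exact_mod_cast hT
  rw [← Real.log_rpow hT']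
  apply Real.log_le_log (by positivity)
  calc (T : ℝ) ^ ρ = ((T : ℝ) ^ (ρ / β)) ^ β := by
        rw [← Real.rpow_mul hT'.le, div_mul_cancel₀ _ hβ.ne']
    _ ≤ (windowStart β ρ T : ℝ) ^ β := by
        gcongr
        exact Nat.le_ceil _
    _ ≤ epoch β (windowStart β ρ T) := rpow_le_epoch _ _
    _ ≤ t := by exact_mod_cast ht.le

lemma eventually_mul_log_lt_windowStart_rpow {β ρ : ℝ} (hβ : 1 < β) (hρ : 0 < ρ) (C D : ℝ) :
    ∀ᶠ T : ℕ in atTop, D * (C * Real.log T + 1) < (windowStart β ρ T : ℝ) ^ (β - 1) - 1 := by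
  have hs : 0 < ρ / β * (β - 1) := mul_pos (by positivity) (by linarith)
  have h1 : (fun y : ℝ => D * (C * Real.log y + 1) + 1)
      =o[atTop] fun y : ℝ => y ^ (ρ / β * (β - 1)) := by
    have hc (c : ℝ) : (fun _ : ℝ => c) =o[atTop] fun y : ℝ => y ^ (ρ / β * (β - 1)) :=
      Asymptotics.isLittleO_const_left.2
        (Or.inr (tendsto_norm_atTop_atTop.comp (tendsto_rpow_atTop hs)))
    exact ((((isLittleO_log_rpow_atTop hs).const_mul_left C).add (hc 1)).const_mul_left D).add
      (hc 1)
  have h2 := tendsto_natCast_atTop_atTop.eventually (h1.bound (half_pos one_pos))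
  filter_upwards [h2, eventually_gt_atTop 0] with T h3 hT
  have hT' : (0 : ℝ) < T := by exact_mod_cast hT
  have h4 : (T : ℝ) ^ (ρ / β * (β - 1)) ≤ (windowStart β ρ T : ℝ) ^ (β - 1) := by
    rw [Real.rpow_mul hT'.le]
    exact Real.rpow_le_rpow (by positivity) (Nat.le_ceil _) (by linarith)
  have h5 : 0 < (T : ℝ) ^ (ρ / β * (β - 1)) := by positivity
  rw [Real.norm_of_nonneg h5.le] at h3
  linarith [le_abs_self (D * (C * Real.log T + 1) + 1), Real.norm_eq_abs
    (D * (C * Real.log T + 1) + 1)]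

/-! ### The regret bound in probability. -/

section Regret

variable {n K : ℕ} [NeZero K] {μ : Fin K → unitInterval} {α β : ℝ}
  {sticky : Fin n → Finset (Fin K)}

lemma le_regret_of_le_plays (hbest : ∀ k, k ≠ 0 → μ k < μ 0) {x : Randomness n K} {i : Fin n}
    {T : ℕ} {c : ℝ}
    (h : ∀ k, k ≠ 0 → c / gap μ k ^ 2 ≤ (state α β sticky x T).plays i k) :
    c * ∑ k ∈ Finset.univ.erase (0 : Fin K), 1 / gap μ k ≤ regret μ α β sticky x i T := by
  have h0 : gap μ 0 = 0 := sub_self _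
  rw [regret_eq_sum_plays, ← Finset.add_sum_erase _ _ (Finset.mem_univ (0 : Fin K)), h0,
    zero_mul, zero_add, Finset.mul_sum]
  refine Finset.sum_le_sum fun k hk => ?_
  have hk0 := Finset.ne_of_mem_erase hk
  have hgap : 0 < gap μ k := sub_pos.2 (hbest k hk0)
  calc c * (1 / gap μ k) = gap μ k * (c / gap μ k ^ 2) := by field_simp
    _ ≤ _ := by gcongr; exact h k hk0

variable {Ω : Type*} [MeasurableSpace Ω] {P : Measure Ω} [IsProbabilityMeasure P]
  {ξ : Ω → Randomness n K}

lemma IsModel.tendsto_measureReal_le_regret (hξ : IsModel P μ sticky ξ) (hanti : Antitone μ)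
    (hbest : ∀ k, k ≠ 0 → μ k < μ 0) (hβ : 1 < β) {q : ℝ} (hq : 0 < q) (hqα : q < √α - 1)
    (i : Fin n) :
    Tendsto (fun T : ℕ => P.real {ω | q ^ 2 * Real.log T
      * ∑ k ∈ Finset.univ.erase (0 : Fin K), 1 / gap μ k ≤ regret μ α β sticky (ξ ω) i T})
      atTop (𝓝 1) := by
  obtain ⟨r, hqr, hrα⟩ := exists_between hqα
  have hr : 0 < r := hq.trans hqr
  have hα : 0 < α := Real.sqrt_pos.1 (by linarith)
  -- The earliest window for which the bonus keeps `1 + r` units: `α ρ = (1 + r)²`.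
  set ρ : ℝ := (1 + r) ^ 2 / α with hρ
  have hρ0 : 0 < ρ := by positivity
  have hρ1 : ρ < 1 := by
    rw [hρ, div_lt_one hα, ← Real.sq_sqrt hα.le]
    gcongr
    linarith
  have hn : 1 ≤ (n : ℝ) := by exact_mod_cast i.pos
  have hK : 1 ≤ (K : ℝ) := by exact_mod_cast NeZero.one_le
  have hp0 : 0 < 1 / (n : ℝ) * (1 / K) := by positivity
  have hp1 : 1 / (n : ℝ) * (1 / K) ≤ 1 := by
    rw [one_div_mul_one_div]
    exact (div_le_one (by positivity)).2 (one_le_mul_of_one_le_of_one_le hn hK)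
  have hbad : Tendsto (fun T : ℕ => 1 - (P.real {ω | ¬ Concentrated μ (ξ ω) i T}
      + ∑ _k : Fin K, (1 - 1 / (n : ℝ) * (1 / K)) ^ windowLength β ρ T)) atTop (𝓝 1) := by
    have h1 : Tendsto (fun T : ℕ => (1 - 1 / (n : ℝ) * (1 / K)) ^ windowLength β ρ T) atTop
        (𝓝 0) := (tendsto_pow_atTop_nhds_zero_of_lt_one (by linarith) (by linarith)).comp
      (tendsto_windowLength (by linarith) hρ0 hρ1)
    simpa using ((hξ.tendsto_measureReal_not_concentrated i).add
      (tendsto_finsetSum Finset.univ fun (_ : Fin K) _ => h1)).const_sub 1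
  refine tendsto_of_tendsto_of_tendsto_of_le_of_le' hbad tendsto_const_nhds ?_
    (Eventually.of_forall fun T => measureReal_le_one)
  have hlong : ∀ᶠ T : ℕ in atTop, ∀ k : Fin K,
      K * (((1 + √α) / (gap μ k * (r / q - 1))) ^ 2 * Real.log T + 1)
        < (windowStart β ρ T : ℝ) ^ (β - 1) - 1 :=
    eventually_all.2 fun k => eventually_mul_log_lt_windowStart_rpow hβ hρ0 _ _
  filter_upwards [hlong, eventually_gt_atTop 0] with T hT hT0
  set A := {ω | q ^ 2 * Real.log T * ∑ k ∈ Finset.univ.erase (0 : Fin K), 1 / gap μ k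
    ≤ regret μ α β sticky (ξ ω) i T} with hA
  set N : Fin K → Set Ω := fun k => ⋂ l ∈ Finset.range (windowLength β ρ T),
    (maliciousEvent ξ i k (windowStart β ρ T + 1 + l))ᶜ with hN
  -- The regret bound can fail only without concentration or if some arm is never recommended in the
  -- window. Subadditivity then bounds `P.real A` from below without measurability of `A`.
  have hcover : (Set.univ : Set Ω)
      ⊆ A ∪ ({ω | ¬ Concentrated μ (ξ ω) i T} ∪ ⋃ k ∈ (Finset.univ : Finset (Fin K)), N k) := by
    intro ω _
    by_cases hC : Concentrated μ (ξ ω) i T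
    swap
    · exact Or.inr (Or.inl hC)
    by_cases hW : ∃ k, ω ∈ N k
    · obtain ⟨k, hk⟩ := hW
      exact Or.inr (Or.inr (Set.mem_biUnion (Finset.mem_univ k) hk))
    refine Or.inl (le_regret_of_le_plays hbest fun k hk => ?_)
    have hW' : ω ∉ N k := fun h => hW ⟨k, h⟩
    simp only [hN, Set.mem_iInter, not_forall, Finset.mem_range] at hW'
    obtain ⟨l, hl, hmem⟩ := hW'
    obtain ⟨hc, hm⟩ := Set.notMem_compl_iff.1 hmem
    rw [add_right_comm] at hc hm
    refine le_plays_of_malicious (hξ.tie_mem ω) hanti hα.le hβ hC (Nat.le_add_right _ l)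
      (epoch_le_of_lt_windowLength (by linarith) hl) hc hm (sub_pos.2 (hbest k hk)) hq hqr
      (fun t ht => ?_) (hT k)
    have h1 := mul_log_le_log_of_epoch_windowStart_lt (by linarith) hT0 ht
    rw [hρ, div_mul_eq_mul_div, div_le_iff₀ hα] at h1
    linarith
  have h2 := (measureReal_mono (μ := P) hcover).trans ((measureReal_union_le _ _).trans
    (add_le_add_right ((measureReal_union_le _ _).trans
      (add_le_add_right (measureReal_biUnion_finset_le _ _) _)) _))
  simp only [hN, hξ.measureReal_iInter_maliciousEvent_compl, probReal_univ] at h2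
  linarith

end Regret

end GossipBandit

theorem mainTheorem2 {Ω : Type*} [MeasurableSpace Ω] (P : Measure Ω) [IsProbabilityMeasure P]
    (n K S : ℕ) [NeZero K] (μ : Fin K → unitInterval)
    (hμ : ∀ k, 0 < μ k ∧ μ k < 1) (hanti : Antitone μ) (hbest : ∀ k, k ≠ 0 → μ k < μ 0)
    (α β : ℝ) (hα : 1 < α) (hβ : 1 < β)
    (sticky : Fin n → Finset (Fin K)) (hS : ∀ i, (sticky i).card = S)
    (hsticky : ∃ i, (0 : Fin K) ∈ sticky i)
    (ξ : Ω → GossipBandit.Randomness n K) (hξ : GossipBandit.IsModel P μ sticky ξ)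
    (i : Fin n) :
    (∀ ε : ℝ, 0 < ε → ε < 1 →
      Tendsto (fun T : ℕ =>
        P.real {ω | (1 - ε) * (α * (1 - 1 / √α) ^ 2
            * ∑ k ∈ Finset.univ.erase (0 : Fin K), 1 / GossipBandit.gap μ k)
          ≤ GossipBandit.regret μ α β sticky (ξ ω) i T / Real.log (T : ℝ)}) atTop (𝓝 1)) ∧
    (∀ T : ℕ, Integrable (fun ω => GossipBandit.regret μ α β sticky (ξ ω) i T) P) ∧
    ((α * (1 - 1 / √α) ^ 2
        * ∑ k ∈ Finset.univ.erase (0 : Fin K), 1 / GossipBandit.gap μ k : ℝ) : EReal)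
      ≤ liminf (fun T : ℕ =>
          (((∫ ω, GossipBandit.regret μ α β sticky (ξ ω) i T ∂P) / Real.log (T : ℝ) : ℝ)
            : EReal)) atTop := by
  have hsqrt : 1 < √α := Real.lt_sqrt_of_sq_lt (by linarith)
  have hc : α * (1 - 1 / √α) ^ 2 = (√α - 1) ^ 2 := by
    nth_rewrite 1 [← Real.sq_sqrt (by linarith : 0 ≤ α)]
    field_simp
  have hprob : ∀ ε : ℝ, 0 < ε → ε < 1 → Tendsto (fun T : ℕ =>
      P.real {ω | (1 - ε) * (α * (1 - 1 / √α) ^ 2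
          * ∑ k ∈ Finset.univ.erase (0 : Fin K), 1 / GossipBandit.gap μ k)
        ≤ GossipBandit.regret μ α β sticky (ξ ω) i T / Real.log (T : ℝ)}) atTop (𝓝 1) := by
    intro ε hε0 hε1
    have hs1 : √(1 - ε) < 1 := by
      rw [Real.sqrt_lt' one_pos]
      linarith
    -- This `q` gives `q² = (1 - ε) (√α - 1)²`.
    have h := hξ.tendsto_measureReal_le_regret hanti hbest hβ (α := α)
      (q := √(1 - ε) * (√α - 1))
      (mul_pos (Real.sqrt_pos.2 (by linarith)) (by linarith))
      (mul_lt_of_lt_one_left (by linarith) hs1) i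
    refine h.congr' ?_
    filter_upwards [eventually_gt_atTop 1] with T hT
    have hlog : 0 < Real.log T := Real.log_pos (by exact_mod_cast hT)
    congr 1
    ext ω
    rw [Set.mem_ofPred_eq, Set.mem_ofPred_eq, le_div_iff₀ hlog, mul_pow,
      Real.sq_sqrt (by linarith), hc]
    ring_nf
  refine ⟨hprob, hξ.integrable_regret hanti i, ?_⟩
  set c := α * (1 - 1 / √α) ^ 2 * ∑ k ∈ Finset.univ.erase (0 : Fin K), 1 / GossipBandit.gap μ k
  have key (ε : ℝ) (hε0 : 0 < ε) (hε1 : ε < 1) : (((1 - ε) * c : ℝ) : EReal)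
      ≤ liminf (fun T : ℕ => (((∫ ω, GossipBandit.regret μ α β sticky (ξ ω) i T ∂P)
        / Real.log (T : ℝ) : ℝ) : EReal)) atTop := by
    have h1 := (hprob ε hε0 hε1).const_mul ((1 - ε) * c)
    rw [mul_one] at h1
    have h2 := (continuous_coe_real_ereal.tendsto _).comp h1
    rw [← h2.liminf_eq]
    refine liminf_le_liminf (Eventually.of_forall fun T => ?_)
    rw [Function.comp_apply, EReal.coe_le_coe_iff, ← integral_div]
    -- Markov's inequality for the nonnegative normalized regret at level `(1 - ε) c`.
    exact mul_meas_ge_le_integral_of_nonneg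
      (Eventually.of_forall fun ω => div_nonneg (GossipBandit.regret_nonneg hanti _ i T)
        (Real.log_natCast_nonneg T)) ((hξ.integrable_regret hanti i T).div_const _) _
  -- Let `ε = 1 / (m + 2)`, which stays strictly between 0 and 1 for every `m`.
  have hlim : Tendsto (fun m : ℕ => (((1 - 1 / ((m : ℝ) + 1 + 1)) * c : ℝ) : EReal)) atTop
      (𝓝 (c : EReal)) := by
    have h1 := (((tendsto_one_div_add_atTop_nhds_zero_nat (𝕜 := ℝ)).comp
      (tendsto_add_atTop_nat 1)).const_sub 1).mul_const c
    rw [sub_zero, one_mul] at h1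
    refine ((continuous_coe_real_ereal.tendsto _).comp h1).congr fun m => ?_
    simp
  refine le_of_tendsto' hlim fun m => key _ (by positivity) ?_
  rw [div_lt_one (by positivity)]
  linarith [(m.cast_nonneg : (0 : ℝ) ≤ m)]
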